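/- Let $\log$ denote the binary logarithm, let $H(p)=-p\log p-(1-p)\log(1-p)$ for $p\in[0,1]$ (with $0\log 0=0$) be the binary Shannon entropy, and let $N(p,\tau)=p(1-\tau)+(1-p)\tau$. For $\tau\in(0,1)$ and $x\in\{0,1\}^n$ let $N_\tau(x)$ be the random string obtained from $x$ by flipping each bit independently with probability $\tau$. Proposition. There is an absolute constant $C>0$ (independent of $n$, $p$, $\tau$, $A$, $B$) such that the following holds for all integers $n\ge 1$, all $p\in[0,1]$ and all $\tau\in(0,1)$. Put $\alpha=H(p)$ and $\beta=H(N(p,\tau))$. Let $A,B\subseteq\{0,1\}^n$ be sets, $A$ non-empty, such that $\Pr[N_\tau(x)\in B]\ge 1/n$ for every $x\in A$. If $\log\#A\ge\alpha n$, then $B$ is non-empty and $$\log\#B\ \ge\ \beta n-C\sqrt{n}\,\log^{3/2}n .$$ -/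

import Mathlib

open MeasureTheory

/-- The binary (base 2) Shannon entropy `H(p) = -p log₂ p - (1-p) log₂ (1-p)`, with `0 log 0 = 0`.
Mathlib's `Real.binEntropy` is the same function measured with natural logarithms. -/
noncomputable def shannonH (p : ℝ) : ℝ := Real.binEntropy p / Real.log 2

/-- `N(p,τ) = p(1-τ) + (1-p)τ`, the probability that a bit is changed in total, when it is first
changed with probability `p` and then, independently, with probability `τ`. -/
def noiseParam (p τ : ℝ) : ℝ := p * (1 - τ) + (1 - p) * τ

/-- The law of the bit `b` after it is flipped with probability `τ` (meaningful for `0 ≤ τ ≤ 1`). -/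
noncomputable def bitNoise (τ : ℝ) (b : Bool) : Measure Bool :=
  ENNReal.ofReal (1 - τ) • Measure.dirac b + ENNReal.ofReal τ • Measure.dirac (!b)

/-- The law of `N_τ(x)`: every bit of `x` is flipped with probability `τ`, independently of the
other bits. -/
noncomputable def noise {n : ℕ} (τ : ℝ) (x : Fin n → Bool) : Measure (Fin n → Bool) :=
  Measure.pi fun i => bitNoise τ (x i)

/-! ### The scalar inequality -/

/-! Send the uniform law on `A`, of entropy at least `H(p) n`, through the channel and estimate the
output entropy twice. Lower bound: by Mrs. Gerber's lemma it is at least `H(N(p,τ)) n`. Convexity of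
`H ∘ N(·,τ) ∘ H⁻¹` is used only through a supporting line of slope `s ≥ 0` at `H(p)`
(`exists_supportsNoise`). Such an affine bound passes from one bit to `n` bits by the chain rule
(`finEntropy_noise_ge`). Upper bound: hitting `B` with probability `1/n` forces the output to lie
within `r = O(√(n log n))` of `B` except with probability `1/n`
(`sum_noiseWeight_compl_hammingThickening_le`). The output entropy is then at most the log-size of
that thickening plus `O(1)` (`finEntropy_le_of_concentrated`). Thickening multiplies the size of `B`
by at most `e n^r` (`card_hammingThickening_le`), and `r log n` is the error term. -/

lemma noiseParam_mem_Ioo {τ q : ℝ} (hτ0 : 0 < τ) (hτ1 : τ < 1) (hq0 : 0 ≤ q) (hq1 : q ≤ 1) :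
    noiseParam q τ ∈ Set.Ioo (0 : ℝ) 1 := by
  unfold noiseParam
  constructor
  · rcases eq_or_lt_of_le hq0 with rfl | h
    · simpa using hτ0
    · nlinarith [mul_pos h (sub_pos.2 hτ1), mul_nonneg (sub_nonneg.2 hq1) hτ0.le]
  · rcases eq_or_lt_of_le hq0 with rfl | h
    · simpa using hτ1
    · nlinarith [mul_pos h hτ0, mul_nonneg (sub_nonneg.2 hq1) (sub_pos.2 hτ1).le]

lemma noiseParam_one_sub (q τ : ℝ) : noiseParam (1 - q) τ = 1 - noiseParam q τ := by
  unfold noiseParam; ring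

lemma hasDerivAt_noiseParam (q τ : ℝ) :
    HasDerivAt (fun q => noiseParam q τ) (1 - 2 * τ) q := by
  have h := ((hasDerivAt_id q).mul_const (1 - τ)).add
    (((hasDerivAt_id q).const_sub 1).mul_const τ)
  refine (h.congr_deriv (by ring)).congr_of_eventuallyEq (.of_forall fun _ => ?_)
  simp [noiseParam]

/-- The derivative of the binary entropy. -/
noncomputable def entropySlope (q : ℝ) : ℝ := Real.log (1 - q) - Real.log q

lemma entropySlope_half : entropySlope (1 / 2) = 0 := by norm_num [entropySlope]

lemma entropySlope_pos {q : ℝ} (h0 : 0 < q) (h1 : q < 1 / 2) : 0 < entropySlope q :=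
  sub_pos.2 (Real.log_lt_log h0 (by linarith))

lemma hasDerivAt_entropySlope {q : ℝ} (h0 : 0 < q) (h1 : q < 1) :
    HasDerivAt entropySlope (-(q * (1 - q))⁻¹) q := by
  have h := (((hasDerivAt_id q).const_sub 1).log (sub_pos.2 h1).ne').sub
    (Real.hasDerivAt_log h0.ne')
  refine h.congr_deriv ?_
  have : 1 - q ≠ 0 := (sub_pos.2 h1).ne'
  simp only [id]
  field_simp
  ring

/-- The derivative of `q ↦ H(N(q,τ))`. -/
noncomputable def noisySlope (τ q : ℝ) : ℝ := (1 - 2 * τ) * entropySlope (noiseParam q τ)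

lemma noisySlope_half (τ : ℝ) : noisySlope τ (1 / 2) = 0 := by
  have : noiseParam (1 / 2) τ = 1 / 2 := by unfold noiseParam; ring
  rw [noisySlope, this, entropySlope_half, mul_zero]

/-- The ratio of the second derivatives of `q ↦ H(N(q,τ))` and `H`. -/
noncomputable def curvatureRatio (τ q : ℝ) : ℝ :=
  (1 - 2 * τ) ^ 2 * (q * (1 - q)) / (noiseParam q τ * (1 - noiseParam q τ))

lemma hasDerivAt_noisySlope {τ q : ℝ} (hτ0 : 0 < τ) (hτ1 : τ < 1) (h0 : 0 < q) (h1 : q < 1) :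
    HasDerivAt (noisySlope τ) (curvatureRatio τ q * -(q * (1 - q))⁻¹) q := by
  obtain ⟨hN0, hN1⟩ := noiseParam_mem_Ioo hτ0 hτ1 h0.le h1.le
  have h := ((hasDerivAt_entropySlope hN0 hN1).comp q (hasDerivAt_noiseParam q τ)).const_mul
    (1 - 2 * τ)
  refine h.congr_deriv ?_
  have h2 : 1 - q ≠ 0 := (sub_pos.2 h1).ne'
  have h3 : 1 - noiseParam q τ ≠ 0 := (sub_pos.2 hN1).ne'
  have h4 := hN0.ne'
  unfold curvatureRatio
  field_simp

/-- With `t = q(1-q)` and `c = (1-2τ)²` the ratio is `ct/(τ(1-τ)+ct)`, increasing in `t`, and `t`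
increases up to `q = 1/2`. -/
lemma curvatureRatio_mono {τ a b : ℝ} (hτ0 : 0 < τ) (hτ1 : τ < 1) (ha : 0 < a) (hab : a ≤ b)
    (hb : b ≤ 1 / 2) : curvatureRatio τ a ≤ curvatureRatio τ b := by
  obtain ⟨ha0, ha1⟩ := noiseParam_mem_Ioo hτ0 hτ1 ha.le (by linarith : a ≤ 1)
  obtain ⟨hb0, hb1⟩ := noiseParam_mem_Ioo hτ0 hτ1 (ha.le.trans hab) (by linarith : b ≤ 1)
  unfold curvatureRatio
  rw [div_le_div_iff₀ (mul_pos ha0 (sub_pos.2 ha1)) (mul_pos hb0 (sub_pos.2 hb1))]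
  have key : ∀ q, noiseParam q τ * (1 - noiseParam q τ)
      = τ * (1 - τ) + (1 - 2 * τ) ^ 2 * (q * (1 - q)) := by
    intro q; unfold noiseParam; ring
  rw [key, key]
  have h : a * (1 - a) ≤ b * (1 - b) := by nlinarith
  have h2 : 0 ≤ (1 - 2 * τ) ^ 2 * (τ * (1 - τ)) :=
    mul_nonneg (sq_nonneg _) (mul_nonneg hτ0.le (by linarith))
  nlinarith [mul_le_mul_of_nonneg_left h h2]

/-- Monotone L'Hôpital rule: both slopes vanish at `1/2` and the ratio of their derivatives is
monotone, so the ratio of the slopes is too. This is the convexity of `H ∘ N(·,τ) ∘ H⁻¹`. -/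
lemma noisySlope_ratio_mono {τ a b : ℝ} (hτ0 : 0 < τ) (hτ1 : τ < 1) (ha : 0 < a) (hab : a < b)
    (hb : b < 1 / 2) : noisySlope τ a * entropySlope b ≤ noisySlope τ b * entropySlope a := by
  have hd : ∀ x, 0 < x → x < 1 → HasDerivAt (noisySlope τ) _ x :=
    fun x h0 h1 => hasDerivAt_noisySlope hτ0 hτ1 h0 h1
  have hd' : ∀ x, 0 < x → x < 1 → HasDerivAt entropySlope _ x :=
    fun x h0 h1 => hasDerivAt_entropySlope h0 h1
  have cauchy : ∀ u v, 0 < u → u < v → v ≤ 1 / 2 → ∃ c ∈ Set.Ioo u v,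
      (entropySlope v - entropySlope u) * curvatureRatio τ c = noisySlope τ v - noisySlope τ u := by
    intro u v hu huv hv
    obtain ⟨c, hc, h⟩ := exists_ratio_hasDerivAt_eq_ratio_slope (noisySlope τ)
      (fun x => curvatureRatio τ x * -(x * (1 - x))⁻¹) huv
      (fun x hx => (hd x (by linarith [hx.1]) (by linarith [hx.2])).continuousAt.continuousWithinAt)
      (fun x hx => hd x (by linarith [hx.1]) (by linarith [hx.2]))
      entropySlope (fun x => -(x * (1 - x))⁻¹)
      (fun x hx => (hd' x (by linarith [hx.1]) (by linarith [hx.2])).continuousAt.continuousWithinAt)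
      (fun x hx => hd' x (by linarith [hx.1]) (by linarith [hx.2]))
    refine ⟨c, hc, ?_⟩
    have hc0 : 0 < c := by linarith [hc.1]
    have hc1 : 0 < 1 - c := by linarith [hc.2]
    have : -(c * (1 - c))⁻¹ ≠ 0 := neg_ne_zero.2 (inv_pos.2 (mul_pos hc0 hc1)).ne'
    exact mul_right_cancel₀ this (by linarith)
  obtain ⟨ξ, hξ, h1⟩ := cauchy a b ha hab hb.le
  obtain ⟨η, hη, h2⟩ := cauchy b (1 / 2) (ha.trans hab) hb le_rfl
  rw [entropySlope_half, noisySlope_half] at h2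
  have hR : curvatureRatio τ ξ ≤ curvatureRatio τ η :=
    curvatureRatio_mono hτ0 hτ1 (by linarith [hξ.1]) (by linarith [hξ.2, hη.1]) hη.2.le
  have hsb := entropySlope_pos (ha.trans hab) hb
  have hlt : entropySlope b ≤ entropySlope a :=
    sub_le_sub (Real.log_le_log (by linarith) (by linarith)) (Real.log_le_log ha hab.le)
  have h3 : noisySlope τ b = entropySlope b * curvatureRatio τ η := by linarith
  have h4 : noisySlope τ a = noisySlope τ b
      + (entropySlope a - entropySlope b) * curvatureRatio τ ξ := by linarith
  have h5 := mul_le_mul_of_nonneg_left hR (mul_nonneg hsb.le (sub_nonneg.2 hlt))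
  rw [h4, h3]
  nlinarith

/-- `N(q,τ)` is a mixture of `q` and `1-q`, where `H` takes the same value; concavity concludes.
Exchanging `q` and `τ` gives the next lemma. -/
lemma binEntropy_noiseParam_ge {τ q : ℝ} (hτ0 : 0 < τ) (hτ1 : τ < 1) (h0 : 0 ≤ q) (h1 : q ≤ 1) :
    Real.binEntropy q ≤ Real.binEntropy (noiseParam q τ) := by
  have h := Real.strictConcave_binEntropy.concaveOn.2 (show q ∈ Set.Icc 0 1 from ⟨h0, h1⟩)
    (show 1 - q ∈ Set.Icc 0 1 from ⟨by linarith, by linarith⟩)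
    (show 0 ≤ 1 - τ by linarith) hτ0.le (by ring)
  simp only [smul_eq_mul, Real.binEntropy_one_sub] at h
  have e : (1 - τ) * q + τ * (1 - q) = noiseParam q τ := by unfold noiseParam; ring
  rw [e] at h
  linarith

lemma binEntropy_noiseParam_ge_noise {τ q : ℝ} (hτ0 : 0 < τ) (hτ1 : τ < 1) (h0 : 0 ≤ q)
    (h1 : q ≤ 1) : Real.binEntropy τ ≤ Real.binEntropy (noiseParam q τ) := by
  have h := Real.strictConcave_binEntropy.concaveOn.2
    (show τ ∈ Set.Icc 0 1 from ⟨hτ0.le, hτ1.le⟩)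
    (show 1 - τ ∈ Set.Icc 0 1 from ⟨by linarith, by linarith⟩)
    (show 0 ≤ 1 - q by linarith) h0 (by ring)
  simp only [smul_eq_mul, Real.binEntropy_one_sub] at h
  have e : (1 - q) * τ + q * (1 - τ) = noiseParam q τ := by unfold noiseParam; ring
  rw [e] at h
  linarith

/-- The line of slope `s` supports `H ∘ N(·,τ) ∘ H⁻¹` at `H(p)`. -/
def SupportsNoise (τ p s : ℝ) : Prop :=
  ∀ q, 0 ≤ q → q ≤ 1 → Real.binEntropy (noiseParam p τ) - s * Real.binEntropy p ≤
    Real.binEntropy (noiseParam q τ) - s * Real.binEntropy q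

lemma supportsNoise_of_half {τ p s : ℝ}
    (h : ∀ q, 0 ≤ q → q ≤ 1 / 2 → Real.binEntropy (noiseParam p τ) - s * Real.binEntropy p ≤
      Real.binEntropy (noiseParam q τ) - s * Real.binEntropy q) : SupportsNoise τ p s := by
  intro q h0 h1
  rcases le_total q (1 / 2) with hq | hq
  · exact h q h0 hq
  · simpa [noiseParam_one_sub] using h (1 - q) (by linarith) (by linarith)

/-- The slope is the derivative of `H ∘ N(·,τ) ∘ H⁻¹` at `H(p)`. Cauchy's mean value theorem between
`p` and `q` reduces the support property to monotonicity of the slope ratio. -/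
lemma exists_supportsNoise_of_lt_half {τ p : ℝ} (hτ0 : 0 < τ) (hτ1 : τ < 1) (hp0 : 0 < p)
    (hp1 : p < 1 / 2) : ∃ s, 0 ≤ s ∧ SupportsNoise τ p s := by
  have hsp := entropySlope_pos hp0 hp1
  refine ⟨noisySlope τ p / entropySlope p, div_nonneg ?_ hsp.le, supportsNoise_of_half ?_⟩
  · have hN := noiseParam_mem_Ioo hτ0 hτ1 hp0.le (by linarith : p ≤ 1)
    -- Noise keeps `p` on its side of `1/2` exactly when `τ ≤ 1/2`, so both factors of `noisySlope`
    -- change sign together.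
    have e : 1 - 2 * noiseParam p τ = (1 - 2 * τ) * (1 - 2 * p) := by unfold noiseParam; ring
    unfold noisySlope entropySlope
    rcases le_total τ (1 / 2) with h | h
    · have : 0 ≤ (1 - 2 * τ) * (1 - 2 * p) := mul_nonneg (by linarith) (by linarith)
      exact mul_nonneg (by linarith) (sub_nonneg.2 (Real.log_le_log hN.1 (by linarith)))
    · have : (1 - 2 * τ) * (1 - 2 * p) ≤ 0 :=
        mul_nonpos_of_nonpos_of_nonneg (by linarith) (by linarith)
      exact mul_nonneg_of_nonpos_of_nonpos (by linarith)
        (sub_nonpos.2 (Real.log_le_log (sub_pos.2 hN.2) (by linarith)))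
  intro q hq0 hq1
  have hcont : Continuous fun q => Real.binEntropy (noiseParam q τ) := by
    unfold noiseParam; fun_prop
  have hd : ∀ x, 0 < x → x < 1 →
      HasDerivAt (fun q => Real.binEntropy (noiseParam q τ)) (noisySlope τ x) x := by
    intro x h0 h1
    obtain ⟨hN0, hN1⟩ := noiseParam_mem_Ioo hτ0 hτ1 h0.le h1.le
    have h := (Real.hasDerivAt_binEntropy hN0.ne' hN1.ne).comp x (hasDerivAt_noiseParam x τ)
    exact h.congr_deriv (mul_comm _ _)
  have cauchy : ∀ u v, 0 ≤ u → u < v → v ≤ 1 / 2 → ∃ c ∈ Set.Ioo u v,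
      (Real.binEntropy v - Real.binEntropy u) * noisySlope τ c =
        (Real.binEntropy (noiseParam v τ) - Real.binEntropy (noiseParam u τ)) * entropySlope c := by
    intro u v hu huv hv
    exact exists_ratio_hasDerivAt_eq_ratio_slope (fun q => Real.binEntropy (noiseParam q τ))
      (noisySlope τ) huv hcont.continuousOn
      (fun x hx => hd x (by linarith [hx.1]) (by linarith [hx.2]))
      Real.binEntropy entropySlope Real.binEntropy_continuous.continuousOn
      (fun x hx => Real.hasDerivAt_binEntropy (by linarith [hx.1]) (by linarith [hx.2]))
  have hmono : ∀ u v, 0 ≤ u → u < v → v ≤ 1 / 2 → Real.binEntropy u ≤ Real.binEntropy v := by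
    intro u v hu huv hv
    exact Real.binEntropy_strictMonoOn.monotoneOn ⟨hu, by norm_num at *; linarith⟩
      ⟨by linarith, by norm_num at *; linarith⟩ huv.le
  set s := noisySlope τ p / entropySlope p with hs
  rcases lt_trichotomy p q with hpq | rfl | hpq
  · obtain ⟨c, hc, h⟩ := cauchy p q hp0.le hpq hq1
    have hsc := entropySlope_pos (hp0.trans hc.1) (hc.2.trans_le hq1)
    have hr := noisySlope_ratio_mono hτ0 hτ1 hp0 hc.1 (hc.2.trans_le hq1)
    have h1 : s * entropySlope c ≤ noisySlope τ c := by
      rw [hs, div_mul_eq_mul_div, div_le_iff₀ hsp]; exact hr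
    have h2 := mul_le_mul_of_nonneg_left h1 (sub_nonneg.2 (hmono p q hp0.le hpq hq1))
    have h3 : (Real.binEntropy q - Real.binEntropy p) * s ≤
        Real.binEntropy (noiseParam q τ) - Real.binEntropy (noiseParam p τ) :=
      le_of_mul_le_mul_right (by linarith) hsc
    linarith
  · exact le_rfl
  · obtain ⟨c, hc, h⟩ := cauchy q p hq0 hpq hp1.le
    have hsc := entropySlope_pos (hq0.trans_lt hc.1) (hc.2.trans hp1)
    have hr := noisySlope_ratio_mono hτ0 hτ1 (hq0.trans_lt hc.1) hc.2 hp1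
    have h1 : noisySlope τ c ≤ s * entropySlope c := by
      rw [hs, div_mul_eq_mul_div, le_div_iff₀ hsp]; exact hr
    have h2 := mul_le_mul_of_nonneg_left h1 (sub_nonneg.2 (hmono q p hq0 hpq hp1.le))
    have h3 : Real.binEntropy (noiseParam p τ) - Real.binEntropy (noiseParam q τ) ≤
        (Real.binEntropy p - Real.binEntropy q) * s :=
      le_of_mul_le_mul_right (by linarith) hsc
    linarith

/-- The scalar form of Mrs. Gerber's lemma. -/
lemma exists_supportsNoise {τ p : ℝ} (hτ0 : 0 < τ) (hτ1 : τ < 1) (hp0 : 0 ≤ p) (hp1 : p ≤ 1) :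
    ∃ s, 0 ≤ s ∧ SupportsNoise τ p s := by
  have main : ∀ p, 0 ≤ p → p ≤ 1 / 2 → ∃ s, 0 ≤ s ∧ SupportsNoise τ p s := by
    intro p hp0 hp1
    -- At `0` and `1/2` the quotient of slopes is unavailable (`entropySlope` is `0` there in Lean),
    -- so explicit lines of slope `0` and `1` are used.
    rcases eq_or_lt_of_le hp0 with rfl | hp0
    · refine ⟨0, le_rfl, fun q h0 h1 => ?_⟩
      simpa [noiseParam] using binEntropy_noiseParam_ge_noise hτ0 hτ1 h0 h1
    rcases eq_or_lt_of_le hp1 with rfl | hp1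
    · refine ⟨1, zero_le_one, fun q h0 h1 => ?_⟩
      have e : noiseParam (1 / 2) τ = 1 / 2 := by unfold noiseParam; ring
      rw [e]
      linarith [binEntropy_noiseParam_ge hτ0 hτ1 h0 h1]
    · exact exists_supportsNoise_of_lt_half hτ0 hτ1 hp0 hp1
  rcases le_total p (1 / 2) with h | h
  · exact main p hp0 h
  · obtain ⟨s, hs, H⟩ := main (1 - p) (by linarith) (by linarith)
    refine ⟨s, hs, fun q h0 h1 => ?_⟩
    simpa [noiseParam_one_sub] using H q h0 h1

/-! ### Entropy of the output of the noisy channel -/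

/-- The unnormalized entropy of a bit with weights `a` and `b`. -/
noncomputable def bitEntropy (a b : ℝ) : ℝ :=
  Real.negMulLog a + Real.negMulLog b - Real.negMulLog (a + b)

lemma bitEntropy_mul (k a b : ℝ) : bitEntropy (k * a) (k * b) = k * bitEntropy a b := by
  unfold bitEntropy
  rw [← mul_add, Real.negMulLog_mul, Real.negMulLog_mul, Real.negMulLog_mul]
  ring

lemma bitEntropy_eq {a b : ℝ} (ha : 0 ≤ a) (hb : 0 ≤ b) :
    bitEntropy a b = (a + b) * Real.binEntropy (a / (a + b)) := by
  rcases eq_or_ne (a + b) 0 with h | h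
  · obtain rfl : a = 0 := by linarith
    obtain rfl : b = 0 := by linarith
    simp [bitEntropy]
  · have e1 : a = (a + b) * (a / (a + b)) := by field_simp
    have e2 : b = (a + b) * (1 - a / (a + b)) := by field_simp; ring
    conv_lhs => rw [e1]; arg 2; rw [e2]
    rw [bitEntropy_mul, bitEntropy, Real.binEntropy_eq_negMulLog_add_negMulLog_one_sub]
    simp

/-- Forgetting the index `i` cannot lower the conditional entropy of the bit: Jensen for `H` with
weights `(a i + b i)/T`. -/
lemma sum_bitEntropy_le {ι : Type*} (t : Finset ι) {a b : ι → ℝ} (ha : ∀ i ∈ t, 0 ≤ a i)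
    (hb : ∀ i ∈ t, 0 ≤ b i) :
    ∑ i ∈ t, bitEntropy (a i) (b i) ≤ bitEntropy (∑ i ∈ t, a i) (∑ i ∈ t, b i) := by
  have hab : ∀ i ∈ t, 0 ≤ a i + b i := fun i hi => add_nonneg (ha i hi) (hb i hi)
  set T := ∑ i ∈ t, (a i + b i) with hT
  have hTab : ∑ i ∈ t, a i + ∑ i ∈ t, b i = T := Finset.sum_add_distrib.symm
  rw [bitEntropy_eq (Finset.sum_nonneg ha) (Finset.sum_nonneg hb), hTab,
    Finset.sum_congr rfl fun i hi => bitEntropy_eq (ha i hi) (hb i hi)]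
  rcases (Finset.sum_nonneg hab).eq_or_lt with h0 | hpos
  · have hz := (Finset.sum_eq_zero_iff_of_nonneg hab).1 h0.symm
    rw [Finset.sum_eq_zero fun i hi => by rw [hz i hi, zero_mul], hT, ← h0, zero_mul]
  · have hj := Real.strictConcave_binEntropy.concaveOn.le_map_sum (t := t)
      (w := fun i => (a i + b i) / T) (p := fun i => a i / (a i + b i))
      (fun i hi => div_nonneg (hab i hi) hpos.le)
      (by rw [← Finset.sum_div, ← hT, div_self (ne_of_gt hpos)])
      (fun i hi => ⟨div_nonneg (ha i hi) (hab i hi),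
        div_le_one_of_le₀ (by linarith [hb i hi]) (hab i hi)⟩)
    have e : ∑ i ∈ t, ((a i + b i) / T) • (a i / (a i + b i)) = (∑ i ∈ t, a i) / T := by
      rw [Finset.sum_div]
      refine Finset.sum_congr rfl fun i hi => ?_
      rcases eq_or_ne (a i + b i) 0 with h | h
      · have : a i = 0 := by linarith [ha i hi, hb i hi]
        simp [this]
      · rw [smul_eq_mul]; field_simp
    rw [e] at hj
    calc ∑ i ∈ t, (a i + b i) * Real.binEntropy (a i / (a i + b i))
        = T * ∑ i ∈ t, ((a i + b i) / T) • Real.binEntropy (a i / (a i + b i)) := by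
          rw [Finset.mul_sum]
          refine Finset.sum_congr rfl fun i _ => ?_
          rw [smul_eq_mul, ← mul_assoc, mul_div_cancel₀ _ (ne_of_gt hpos)]
      _ ≤ _ := mul_le_mul_of_nonneg_left hj hpos.le

/-- The transition probabilities of the binary symmetric channel. -/
def bitWeight (τ : ℝ) (b c : Bool) : ℝ := if c = b then 1 - τ else τ

lemma bitWeight_pos {τ : ℝ} (hτ0 : 0 < τ) (hτ1 : τ < 1) (b c : Bool) : 0 < bitWeight τ b c := by
  unfold bitWeight; split_ifs <;> linarith

lemma sum_bitWeight (τ : ℝ) (b : Bool) : ∑ c, bitWeight τ b c = 1 := by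
  cases b <;> simp [bitWeight]

lemma bitEntropy_noise_ge {τ p s a b : ℝ} (hτ0 : 0 < τ) (hτ1 : τ < 1)
    (hs : SupportsNoise τ p s) (ha : 0 ≤ a) (hb : 0 ≤ b) :
    s * bitEntropy a b
        + (Real.binEntropy (noiseParam p τ) - s * Real.binEntropy p) * (a + b) ≤
      bitEntropy (a * bitWeight τ false false + b * bitWeight τ true false)
        (a * bitWeight τ false true + b * bitWeight τ true true) := by
  have h1 := fun c d => (bitWeight_pos hτ0 hτ1 c d).le
  rw [bitEntropy_eq ha hb, bitEntropy_eq
    (add_nonneg (mul_nonneg ha (h1 _ _)) (mul_nonneg hb (h1 _ _)))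
    (add_nonneg (mul_nonneg ha (h1 _ _)) (mul_nonneg hb (h1 _ _)))]
  have e : a * bitWeight τ false false + b * bitWeight τ true false
      + (a * bitWeight τ false true + b * bitWeight τ true true) = a + b := by
    simp [bitWeight]; ring
  rw [e]
  rcases eq_or_ne (a + b) 0 with h | h
  · simp [h]
  · have e2 : (a * bitWeight τ false false + b * bitWeight τ true false) / (a + b)
        = noiseParam (a / (a + b)) τ := by
      simp only [bitWeight, noiseParam]
      field_simp
      simp [mul_comm]
    rw [e2]
    have := mul_le_mul_of_nonneg_left (hs (a / (a + b)) (div_nonneg ha (by linarith))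
      (div_le_one_of_le₀ (by linarith) (by linarith))) (add_nonneg ha hb)
    linarith

/-- The entropy of a weight function, in nats. -/
noncomputable def finEntropy {X : Type*} [Fintype X] (P : X → ℝ) : ℝ :=
  ∑ x, Real.negMulLog (P x)

/-- One bit is sent while the others, `X`, become `Y` through `K`. The one-bit bound holds given
`X`; conditioning on the degraded `Y` instead only raises the entropy of the output bit. -/
lemma sum_bitEntropy_channel_ge {X Y : Type*} [Fintype X] [Fintype Y] {τ p s : ℝ} (hτ0 : 0 < τ)
    (hτ1 : τ < 1) (hs : SupportsNoise τ p s) {K : X → Y → ℝ} (hK : ∀ x y, 0 ≤ K x y)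
    (hK1 : ∀ x, ∑ y, K x y = 1) {P : Bool → X → ℝ} (hP : ∀ b x, 0 ≤ P b x) :
    s * ∑ x, bitEntropy (P false x) (P true x)
        + (Real.binEntropy (noiseParam p τ) - s * Real.binEntropy p)
          * ∑ x, (P false x + P true x) ≤
      ∑ y, bitEntropy
        (∑ x, K x y * (P false x * bitWeight τ false false + P true x * bitWeight τ true false))
        (∑ x, K x y * (P false x * bitWeight τ false true + P true x * bitWeight τ true true)) := by
  have hw := fun c d => (bitWeight_pos hτ0 hτ1 c d).le
  have hR : ∀ c x, 0 ≤ P false x * bitWeight τ false c + P true x * bitWeight τ true c :=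
    fun c x => add_nonneg (mul_nonneg (hP _ _) (hw _ _)) (mul_nonneg (hP _ _) (hw _ _))
  calc _ = ∑ x, (s * bitEntropy (P false x) (P true x)
        + (Real.binEntropy (noiseParam p τ) - s * Real.binEntropy p)
          * (P false x + P true x)) := by
        rw [Finset.mul_sum, Finset.mul_sum, Finset.sum_add_distrib]
    _ ≤ ∑ x, bitEntropy (P false x * bitWeight τ false false + P true x * bitWeight τ true false)
          (P false x * bitWeight τ false true + P true x * bitWeight τ true true) :=
        Finset.sum_le_sum fun x _ => bitEntropy_noise_ge hτ0 hτ1 hs (hP _ _) (hP _ _)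
    _ = ∑ y, ∑ x, bitEntropy
          (K x y * (P false x * bitWeight τ false false + P true x * bitWeight τ true false))
          (K x y * (P false x * bitWeight τ false true + P true x * bitWeight τ true true)) := by
        rw [Finset.sum_comm]
        refine Finset.sum_congr rfl fun x _ => ?_
        simp_rw [bitEntropy_mul]
        rw [← Finset.sum_mul, hK1, one_mul]
    _ ≤ _ := Finset.sum_le_sum fun y _ => sum_bitEntropy_le _
        (fun x _ => mul_nonneg (hK _ _) (hR _ _)) (fun x _ => mul_nonneg (hK _ _) (hR _ _))

lemma sum_boolVec_succ {n : ℕ} (f : (Fin (n + 1) → Bool) → ℝ) :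
    ∑ x, f x = ∑ x : Fin n → Bool, (f (Fin.cons false x) + f (Fin.cons true x)) := by
  rw [← (Fin.consEquiv fun _ : Fin (n + 1) => Bool).sum_comp, Fintype.sum_prod_type_right]
  refine Finset.sum_congr rfl fun x _ => ?_
  rw [Fintype.sum_bool, add_comm]
  rfl

/-- Chain rule: entropy of the tail plus conditional entropy of the first bit. -/
lemma finEntropy_succ {n : ℕ} (P : (Fin (n + 1) → Bool) → ℝ) :
    finEntropy P = finEntropy (fun x => P (Fin.cons false x) + P (Fin.cons true x))
      + ∑ x : Fin n → Bool, bitEntropy (P (Fin.cons false x)) (P (Fin.cons true x)) := by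
  unfold finEntropy bitEntropy
  rw [sum_boolVec_succ, ← Finset.sum_add_distrib]
  refine Finset.sum_congr rfl fun x _ => ?_
  ring

/-- The probability that the channel carries `x` to `y`. -/
def noiseWeight {n : ℕ} (τ : ℝ) (x y : Fin n → Bool) : ℝ := ∏ i, bitWeight τ (x i) (y i)

lemma noiseWeight_pos {n : ℕ} {τ : ℝ} (hτ0 : 0 < τ) (hτ1 : τ < 1) (x y : Fin n → Bool) :
    0 < noiseWeight τ x y :=
  Finset.prod_pos fun _ _ => bitWeight_pos hτ0 hτ1 _ _

lemma sum_noiseWeight {n : ℕ} (τ : ℝ) (x : Fin n → Bool) : ∑ y, noiseWeight τ x y = 1 := by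
  unfold noiseWeight
  rw [← Fintype.prod_sum fun i c => bitWeight τ (x i) c]
  simp_rw [sum_bitWeight, Finset.prod_const_one]

lemma noiseWeight_cons {n : ℕ} (τ : ℝ) (a b : Bool) (x y : Fin n → Bool) :
    noiseWeight τ (Fin.cons a x) (Fin.cons b y) = bitWeight τ a b * noiseWeight τ x y := by
  simp [noiseWeight, Fin.prod_univ_succ]

/-- **Mrs. Gerber's lemma**, with a supporting line in place of the convex function. -/
theorem finEntropy_noise_ge {τ p s : ℝ} (hτ0 : 0 < τ) (hτ1 : τ < 1) (hs : SupportsNoise τ p s)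
    {n : ℕ} (P : (Fin n → Bool) → ℝ) (hP : ∀ x, 0 ≤ P x) (hP1 : ∑ x, P x = 1) :
    s * finEntropy P + (Real.binEntropy (noiseParam p τ) - s * Real.binEntropy p) * n ≤
      finEntropy fun y => ∑ x, P x * noiseWeight τ x y := by
  induction n with
  | zero =>
    rw [Fintype.sum_unique] at hP1
    simp [finEntropy, noiseWeight, hP1]
  | succ n ih =>
    have hm : ∑ x : Fin n → Bool, (P (Fin.cons false x) + P (Fin.cons true x)) = 1 := by
      rw [← sum_boolVec_succ, hP1]
    have h1 := ih (fun x => P (Fin.cons false x) + P (Fin.cons true x))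
      (fun x => add_nonneg (hP _) (hP _)) hm
    have h2 := sum_bitEntropy_channel_ge hτ0 hτ1 hs (K := noiseWeight (n := n) τ)
      (fun x y => (noiseWeight_pos hτ0 hτ1 x y).le) (sum_noiseWeight τ)
      (P := fun b x => P (Fin.cons b x)) (fun b x => hP _)
    have hQ : ∀ c (y : Fin n → Bool), ∑ x, P x * noiseWeight τ x (Fin.cons c y) =
        ∑ x, noiseWeight τ x y * (P (Fin.cons false x) * bitWeight τ false c
          + P (Fin.cons true x) * bitWeight τ true c) := by
      intro c y
      rw [sum_boolVec_succ]
      refine Finset.sum_congr rfl fun x _ => ?_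
      rw [noiseWeight_cons, noiseWeight_cons]
      ring
    have hQ' : (fun y : Fin n → Bool => ∑ x, P x * noiseWeight τ x (Fin.cons false y)
        + ∑ x, P x * noiseWeight τ x (Fin.cons true y)) =
        fun y => ∑ x, (P (Fin.cons false x) + P (Fin.cons true x)) * noiseWeight τ x y := by
      funext y
      rw [hQ, hQ, ← Finset.sum_add_distrib]
      refine Finset.sum_congr rfl fun x _ => ?_
      simp [bitWeight]
      ring
    -- The chain rule splits input and output alike; `h1` bounds the tail and `h2` the first bit.
    rw [finEntropy_succ P, finEntropy_succ (fun y => ∑ x, P x * noiseWeight τ x y), hQ']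
    simp_rw [hQ]
    rw [hm] at h2
    push_cast
    linarith

/-- Gibbs' inequality, for the mixture of the uniform laws on `S` and on the whole space. -/
lemma finEntropy_le_of_concentrated {X : Type*} [Fintype X] [DecidableEq X] (Q : X → ℝ)
    (hQ : ∀ x, 0 ≤ Q x) (hQ1 : ∑ x, Q x = 1) (S : Finset X) (hS : S.Nonempty) {ε : ℝ}
    (hε : ∑ x ∈ Sᶜ, Q x ≤ ε) :
    finEntropy Q ≤ Real.log 2 + Real.log S.card + ε * Real.log (Fintype.card X) := by
  have hX : (0 : ℝ) < Fintype.card X := by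
    obtain ⟨x, -⟩ := hS
    exact_mod_cast Fintype.card_pos_iff.2 ⟨x⟩
  have hSc : (0 : ℝ) < S.card := by exact_mod_cast hS.card_pos
  -- `(2M)⁻¹` is the mixture without its second component on `S`, hence of total mass at most `1`.
  let M : X → ℝ := fun x => if x ∈ S then S.card else Fintype.card X
  have hM : ∀ x, 0 < M x := fun x => by simp only [M]; split_ifs <;> assumption
  have hM1 : ∑ x, (2 * M x)⁻¹ ≤ 1 := by
    rw [← Finset.sum_add_sum_compl S]
    have e1 : ∑ x ∈ S, (2 * M x)⁻¹ = 1 / 2 := by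
      rw [Finset.sum_congr rfl fun x hx => by rw [show M x = S.card from if_pos hx]]
      rw [Finset.sum_const, nsmul_eq_mul]
      field_simp
    have e2 : ∑ x ∈ Sᶜ, (2 * M x)⁻¹ ≤ 1 / 2 := by
      rw [Finset.sum_congr rfl fun x hx => by
        rw [show M x = Fintype.card X from if_neg (Finset.mem_compl.1 hx)]]
      rw [Finset.sum_const, nsmul_eq_mul]
      have : ((Sᶜ).card : ℝ) ≤ Fintype.card X := by exact_mod_cast Finset.card_le_univ _
      rw [← div_eq_mul_inv, div_le_iff₀ (by positivity)]
      linarith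
    linarith
  have hpt : ∀ x, Real.negMulLog (Q x) ≤ Q x * Real.log (2 * M x) + ((2 * M x)⁻¹ - Q x) := by
    intro x
    have h2 : 0 < 2 * M x := by linarith [hM x]
    rcases (hQ x).eq_or_lt with h | h
    · rw [← h]; simpa using (hM x).le
    · have := mul_le_mul_of_nonneg_left
        (Real.log_le_sub_one_of_pos (inv_pos.2 (mul_pos h2 h))) h.le
      rw [Real.log_inv, Real.log_mul h2.ne' h.ne', mul_sub, mul_one, mul_inv,
        mul_left_comm, mul_inv_cancel₀ h.ne', mul_one] at this
      unfold Real.negMulLog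
      linarith
  have hlog : ∑ x, Q x * Real.log (2 * M x) ≤
      Real.log 2 + Real.log S.card + ε * Real.log (Fintype.card X) := by
    have e : ∀ x, Q x * Real.log (2 * M x) = Real.log 2 * Q x + Q x * Real.log (M x) := by
      intro x; rw [Real.log_mul two_ne_zero (hM x).ne']; ring
    simp_rw [e]
    rw [Finset.sum_add_distrib, ← Finset.mul_sum, hQ1, ← Finset.sum_add_sum_compl S]
    rw [Finset.sum_congr rfl fun x (hx : x ∈ S) => by rw [show M x = S.card from if_pos hx],
      Finset.sum_congr rfl fun x (hx : x ∈ Sᶜ) => by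
        rw [show M x = Fintype.card X from if_neg (Finset.mem_compl.1 hx)],
      ← Finset.sum_mul, ← Finset.sum_mul]
    have hSle : ∑ x ∈ S, Q x ≤ 1 := by
      rw [← hQ1]; exact Finset.sum_le_univ_sum_of_nonneg hQ
    have h1 : (1 : ℝ) ≤ S.card := by exact_mod_cast hS.card_pos
    have h2 : (1 : ℝ) ≤ Fintype.card X := by exact_mod_cast (show 0 < Fintype.card X by exact_mod_cast hX)
    have := mul_le_mul_of_nonneg_right hSle (Real.log_nonneg h1)
    have := mul_le_mul_of_nonneg_right hε (Real.log_nonneg h2)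
    linarith
  calc finEntropy Q ≤ ∑ x, (Q x * Real.log (2 * M x) + ((2 * M x)⁻¹ - Q x)) :=
        Finset.sum_le_sum fun x _ => hpt x
    _ = ∑ x, Q x * Real.log (2 * M x) + (∑ x, (2 * M x)⁻¹ - 1) := by
        rw [Finset.sum_add_distrib, Finset.sum_sub_distrib, hQ1]
    _ ≤ _ := by linarith

/-! ### Blowing up -/

/-- Multiplied out, only `u₀/u₁ + u₁/u₀` is not a weight; it is at most `2 cosh l` because the ratio
lies in `[e⁻ˡ, eˡ]`. -/
lemma two_point_le {w₀ w₁ u₀ u₁ l : ℝ} (hw₀ : 0 ≤ w₀) (hw₁ : 0 ≤ w₁) (hw : w₀ + w₁ = 1)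
    (hu₀ : 0 < u₀) (hu₁ : 0 < u₁) (h₀ : u₀ ≤ Real.exp l * u₁) (h₁ : u₁ ≤ Real.exp l * u₀) :
    w₀ * u₀⁻¹ + w₁ * u₁⁻¹ ≤ Real.cosh l * (w₀ * u₀ + w₁ * u₁)⁻¹ := by
  have hv : 0 < w₀ * u₀ + w₁ * u₁ := by
    rcases hw₀.eq_or_lt with h | h
    · have : w₁ = 1 := by linarith
      rw [← h, this]; linarith
    · exact add_pos_of_pos_of_nonneg (mul_pos h hu₀) (mul_nonneg hw₁ hu₁.le)
  have hL := Real.exp_pos l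
  have hK : Real.exp l * (2 * Real.cosh l) = Real.exp l ^ 2 + 1 := by
    rw [Real.cosh_eq, Real.exp_neg]; field_simp
  have hr : u₀ ^ 2 + u₁ ^ 2 ≤ 2 * Real.cosh l * (u₀ * u₁) := by
    refine le_of_mul_le_mul_left ?_ hL
    have := mul_nonneg (sub_nonneg.2 h₀) (sub_nonneg.2 h₁)
    rw [show Real.exp l * (2 * Real.cosh l * (u₀ * u₁))
      = Real.exp l * (2 * Real.cosh l) * (u₀ * u₁) by ring, hK]
    nlinarith
  have hc := Real.one_le_cosh l
  rw [← div_eq_mul_inv (Real.cosh l), le_div_iff₀ hv]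
  have e : (w₀ * u₀⁻¹ + w₁ * u₁⁻¹) * (w₀ * u₀ + w₁ * u₁)
      = w₀ ^ 2 + w₁ ^ 2 + w₀ * w₁ * ((u₀ ^ 2 + u₁ ^ 2) / (u₀ * u₁)) := by
    field_simp; ring
  have hr' := mul_le_mul_of_nonneg_left ((div_le_iff₀ (mul_pos hu₀ hu₁)).2 hr)
    (mul_nonneg hw₀ hw₁)
  have h2 : w₁ = 1 - w₀ := by linarith
  rw [e]
  calc _ ≤ w₀ ^ 2 + w₁ ^ 2 + w₀ * w₁ * (2 * Real.cosh l) := by linarith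
    _ ≤ Real.cosh l * (w₀ + w₁) ^ 2 := by nlinarith [sq_nonneg w₀, sq_nonneg w₁]
    _ = _ := by rw [hw]; ring

/-- An exponential moment bound for functions whose logarithm is `l`-Lipschitz. -/
theorem sum_noiseWeight_mul_sum_inv_le {τ l : ℝ} (hτ0 : 0 < τ) (hτ1 : τ < 1) {n : ℕ}
    (x : Fin n → Bool) (u : (Fin n → Bool) → ℝ) (hu : ∀ y, 0 < u y)
    (hlip : ∀ y i b, u (Function.update y i b) ≤ Real.exp l * u y) :
    (∑ y, noiseWeight τ x y * u y) * ∑ y, noiseWeight τ x y * (u y)⁻¹ ≤ Real.cosh l ^ n := by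
  induction n with
  | zero =>
    rw [Fintype.sum_unique, Fintype.sum_unique]
    simp [noiseWeight, (hu _).ne']
  | succ n ih =>
    obtain ⟨a, x, rfl⟩ : ∃ a x', x = Fin.cons a x' := ⟨_, _, (Fin.cons_self_tail x).symm⟩
    have hw := fun c => bitWeight_pos hτ0 hτ1 a c
    -- Averaging out the first bit preserves the Lipschitz condition and costs one factor `cosh l`.
    let v : (Fin n → Bool) → ℝ := fun y =>
      bitWeight τ a false * u (Fin.cons false y) + bitWeight τ a true * u (Fin.cons true y)
    have hv : ∀ y, 0 < v y := fun y => add_pos (mul_pos (hw _) (hu _)) (mul_pos (hw _) (hu _))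
    have h1 : ∑ y, noiseWeight τ (Fin.cons a x) y * u y = ∑ y, noiseWeight τ x y * v y := by
      rw [sum_boolVec_succ]
      refine Finset.sum_congr rfl fun y _ => ?_
      rw [noiseWeight_cons, noiseWeight_cons]
      ring
    have hw1 : bitWeight τ a false + bitWeight τ a true = 1 := by
      rw [add_comm, ← Fintype.sum_bool, sum_bitWeight]
    have hflip : ∀ b c (y : Fin n → Bool), u (Fin.cons b y) ≤ Real.exp l * u (Fin.cons c y) := by
      intro b c y
      simpa using hlip (Fin.cons c y) 0 b
    have h2 : ∑ y, noiseWeight τ (Fin.cons a x) y * (u y)⁻¹ ≤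
        Real.cosh l * ∑ y, noiseWeight τ x y * (v y)⁻¹ := by
      rw [sum_boolVec_succ, Finset.mul_sum]
      refine Finset.sum_le_sum fun y _ => ?_
      rw [noiseWeight_cons, noiseWeight_cons]
      have := mul_le_mul_of_nonneg_left (two_point_le (hw false).le (hw true).le hw1
        (hu (Fin.cons false y)) (hu (Fin.cons true y)) (hflip _ _ _) (hflip _ _ _))
        (noiseWeight_pos hτ0 hτ1 x y).le
      calc _ = _ := by ring
        _ ≤ _ := this
        _ = _ := by simp only [v]; ring
    have h3 := ih x v hv (by
      intro y i b
      simp only [v, Fin.cons_update]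
      have := mul_le_mul_of_nonneg_left (hlip (Fin.cons false y) i.succ b) (hw false).le
      have := mul_le_mul_of_nonneg_left (hlip (Fin.cons true y) i.succ b) (hw true).le
      linarith)
    have hnn : 0 ≤ ∑ y, noiseWeight τ x y * v y :=
      Finset.sum_nonneg fun y _ => mul_nonneg (noiseWeight_pos hτ0 hτ1 x y).le (hv y).le
    rw [h1, pow_succ]
    have := mul_le_mul_of_nonneg_left h2 hnn
    have := mul_le_mul_of_nonneg_left h3 (Real.cosh_pos l).le
    linarith

/-- The points at Hamming distance at most `r` from `B`. -/
noncomputable def hammingThickening {n : ℕ} (r : ℝ) (B : Finset (Fin n → Bool)) :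
    Finset (Fin n → Bool) :=
  B.biUnion fun b => Finset.univ.filter fun y => (hammingDist y b : ℝ) ≤ r

lemma hammingDist_update_le {n : ℕ} (y : Fin n → Bool) (i : Fin n) (b : Bool) :
    hammingDist (Function.update y i b) y ≤ 1 := by
  unfold hammingDist
  refine (Finset.card_le_card (t := {i}) fun j hj => ?_).trans_eq (Finset.card_singleton i)
  by_contra h
  simp_all

/-- Apply the moment bound to `u = exp(l · dist(·, B))`. Since `u = 1` on `B`, the mean of `u⁻¹` is
at least `m`, so the mean of `u` is at most `coshⁿ l / m ≤ exp(nl²/2)/m`; Markov's inequality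
finishes. -/
lemma sum_noiseWeight_compl_hammingThickening_le {τ l r m : ℝ} (hτ0 : 0 < τ) (hτ1 : τ < 1)
    (hl : 0 ≤ l) (hm : 0 < m) {n : ℕ} (x : Fin n → Bool) {B : Finset (Fin n → Bool)}
    (hB : B.Nonempty) (hxB : m ≤ ∑ y ∈ B, noiseWeight τ x y) :
    ∑ y ∈ (hammingThickening r B)ᶜ, noiseWeight τ x y ≤
      m⁻¹ * Real.exp (n * l ^ 2 / 2 - l * r) := by
  let d : (Fin n → Bool) → ℕ := fun y => B.inf' hB (hammingDist y)
  let u : (Fin n → Bool) → ℝ := fun y => Real.exp (l * d y)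
  have hW := fun y => (noiseWeight_pos hτ0 hτ1 x y).le
  have hlip : ∀ y i b, u (Function.update y i b) ≤ Real.exp l * u y := by
    intro y i b
    have hd : d (Function.update y i b) ≤ d y + 1 := by
      obtain ⟨c, hc, hcd⟩ := Finset.exists_mem_eq_inf' hB (hammingDist y)
      have h1 : d (Function.update y i b) ≤ hammingDist (Function.update y i b) c :=
        Finset.inf'_le _ hc
      have h2 := hammingDist_triangle (Function.update y i b) y c
      have h3 := hammingDist_update_le y i b
      have h4 : d y = hammingDist y c := hcd
      omega
    have hd' : (d (Function.update y i b) : ℝ) ≤ d y + 1 := by exact_mod_cast hd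
    rw [← Real.exp_add]
    exact Real.exp_le_exp.2 (by nlinarith)
  have key := sum_noiseWeight_mul_sum_inv_le hτ0 hτ1 x u (fun y => Real.exp_pos _) hlip
  have hinv : m ≤ ∑ y, noiseWeight τ x y * (u y)⁻¹ := by
    refine hxB.trans ?_
    calc ∑ y ∈ B, noiseWeight τ x y = ∑ y ∈ B, noiseWeight τ x y * (u y)⁻¹ := by
          refine Finset.sum_congr rfl fun y hy => ?_
          have h0 : d y ≤ hammingDist y y := Finset.inf'_le _ hy
          rw [hammingDist_self] at h0
          simp [u, Nat.le_zero.1 h0]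
      _ ≤ _ := Finset.sum_le_univ_sum_of_nonneg fun y =>
          mul_nonneg (hW y) (inv_nonneg.2 (Real.exp_pos _).le)
  have hmark : Real.exp (l * r) * ∑ y ∈ (hammingThickening r B)ᶜ, noiseWeight τ x y ≤
      ∑ y, noiseWeight τ x y * u y := by
    rw [Finset.mul_sum]
    calc _ ≤ ∑ y ∈ (hammingThickening r B)ᶜ, noiseWeight τ x y * u y := by
          refine Finset.sum_le_sum fun y hy => ?_
          obtain ⟨c, hc, hcd⟩ := Finset.exists_mem_eq_inf' hB (hammingDist y)
          have hlt : r ≤ d y := by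
            by_contra! h
            refine Finset.mem_compl.1 hy (Finset.mem_biUnion.2 ⟨c, hc, ?_⟩)
            have h4 : d y = hammingDist y c := hcd
            rw [h4] at h
            simpa using h.le
          rw [mul_comm]
          exact mul_le_mul_of_nonneg_left
            (Real.exp_le_exp.2 (mul_le_mul_of_nonneg_left hlt hl)) (hW y)
      _ ≤ _ := Finset.sum_le_univ_sum_of_nonneg fun y => mul_nonneg (hW y) (Real.exp_pos _).le
  have hcosh : Real.cosh l ^ n ≤ Real.exp (n * l ^ 2 / 2) := by
    calc _ ≤ Real.exp (l ^ 2 / 2) ^ n :=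
          pow_le_pow_left₀ (Real.cosh_pos l).le (Real.cosh_le_exp_half_sq l) n
      _ = _ := by rw [← Real.exp_nat_mul]; ring_nf
  have hu0 : 0 ≤ ∑ y, noiseWeight τ x y * u y :=
    Finset.sum_nonneg fun y _ => mul_nonneg (hW y) (Real.exp_pos _).le
  have hfin := ((mul_le_mul_of_nonneg_left hinv hu0).trans key).trans hcosh
  rw [Real.exp_sub, ← div_eq_inv_mul, div_div, le_div_iff₀ (by positivity)]
  have := mul_le_mul_of_nonneg_right hmark hm.le
  linarith

lemma subset_hammingThickening {n : ℕ} {r : ℝ} (hr : 0 ≤ r) (B : Finset (Fin n → Bool)) :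
    B ⊆ hammingThickening r B := fun b hb =>
  Finset.mem_biUnion.2 ⟨b, hb, by simpa using hr⟩

/-- Give `y` the weight `n^(-dist)`: the total is `(1+1/n)ⁿ ≤ e`, and each point of the ball has
weight at least `n^(-r)`. -/
lemma card_hammingBall_le {n : ℕ} (hn : 1 ≤ n) (r : ℝ) (b : Fin n → Bool) :
    ((Finset.univ.filter fun y => (hammingDist y b : ℝ) ≤ r).card : ℝ) ≤
      Real.exp 1 * (n : ℝ) ^ r := by
  have hn0 : (0 : ℝ) < n := by exact_mod_cast hn
  have hn1 : (1 : ℝ) ≤ n := by exact_mod_cast hn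
  have hsum : ∑ y : Fin n → Bool, ((n : ℝ)⁻¹) ^ hammingDist y b = (1 + (n : ℝ)⁻¹) ^ n := by
    calc _ = ∑ y : Fin n → Bool, ∏ i, (if y i ≠ b i then (n : ℝ)⁻¹ else 1) := by
          refine Finset.sum_congr rfl fun y _ => ?_
          rw [Finset.prod_ite, Finset.prod_const, Finset.prod_const_one, mul_one, hammingDist]
      _ = ∏ i, ∑ c, (if c ≠ b i then (n : ℝ)⁻¹ else 1) :=
          (Fintype.prod_sum fun i c => if c ≠ b i then (n : ℝ)⁻¹ else 1).symm
      _ = ∏ _i : Fin n, (1 + (n : ℝ)⁻¹) := by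
          refine Finset.prod_congr rfl fun i _ => ?_
          cases b i <;> simp [add_comm]
      _ = _ := by simp
  have hexp : (1 + (n : ℝ)⁻¹) ^ n ≤ Real.exp 1 := by
    calc _ ≤ Real.exp ((n : ℝ)⁻¹) ^ n :=
          pow_le_pow_left₀ (by positivity) (by linarith [Real.add_one_le_exp ((n : ℝ)⁻¹)]) n
      _ = _ := by rw [← Real.exp_nat_mul, mul_inv_cancel₀ hn0.ne']
  calc _ = ∑ y ∈ Finset.univ.filter fun y : Fin n → Bool => (hammingDist y b : ℝ) ≤ r,
        (1 : ℝ) := by simp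
    _ ≤ ∑ y ∈ Finset.univ.filter fun y : Fin n → Bool => (hammingDist y b : ℝ) ≤ r,
        ((n : ℝ)⁻¹) ^ hammingDist y b * (n : ℝ) ^ r := by
        refine Finset.sum_le_sum fun y hy => ?_
        rw [inv_pow, ← Real.rpow_natCast, ← div_eq_inv_mul, one_le_div (by positivity)]
        exact Real.rpow_le_rpow_of_exponent_le hn1 (Finset.mem_filter.1 hy).2
    _ ≤ ∑ y : Fin n → Bool, ((n : ℝ)⁻¹) ^ hammingDist y b * (n : ℝ) ^ r :=
        Finset.sum_le_univ_sum_of_nonneg fun y => by positivity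
    _ = (1 + (n : ℝ)⁻¹) ^ n * (n : ℝ) ^ r := by rw [← Finset.sum_mul, hsum]
    _ ≤ _ := mul_le_mul_of_nonneg_right hexp (by positivity)

lemma card_hammingThickening_le {n : ℕ} (hn : 1 ≤ n) (r : ℝ) (B : Finset (Fin n → Bool)) :
    ((hammingThickening r B).card : ℝ) ≤ B.card * (Real.exp 1 * (n : ℝ) ^ r) := by
  calc _ ≤ ∑ b ∈ B, ((Finset.univ.filter fun y => (hammingDist y b : ℝ) ≤ r).card : ℝ) := by
        exact_mod_cast Finset.card_biUnion_le
    _ ≤ ∑ _b ∈ B, Real.exp 1 * (n : ℝ) ^ r :=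
        Finset.sum_le_sum fun b _ => card_hammingBall_le hn r b
    _ = _ := by rw [Finset.sum_const, nsmul_eq_mul]

/-! ### The noise measure -/

instance (τ : ℝ) (b : Bool) : IsFiniteMeasure (bitNoise τ b) := by
  unfold bitNoise
  have (c : Bool) (t : ℝ) : IsFiniteMeasure (ENNReal.ofReal t • Measure.dirac c) :=
    Measure.smul_finite _ ENNReal.ofReal_ne_top
  infer_instance

lemma noise_real_eq {n : ℕ} {τ : ℝ} (hτ0 : 0 < τ) (hτ1 : τ < 1) (x : Fin n → Bool)
    (B : Finset (Fin n → Bool)) : (noise τ x).real B = ∑ y ∈ B, noiseWeight τ x y := by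
  have hbit : ∀ b c : Bool, (bitNoise τ b).real {c} = bitWeight τ b c := by
    intro b c
    cases b <;> cases c <;>
      simp [Measure.real, bitNoise, bitWeight, hτ0.le, hτ1.le]
  have : IsFiniteMeasure (noise τ x) := by unfold noise; infer_instance
  rw [← sum_measureReal_singleton]
  refine Finset.sum_congr rfl fun y _ => ?_
  rw [Measure.real, noise, Measure.pi_singleton, ENNReal.toReal_prod]
  exact Finset.prod_congr rfl fun i _ => hbit _ _

/-! ### The theorem -/

lemma finEntropy_uniform {X : Type*} [Fintype X] [DecidableEq X] {A : Finset X}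
    (hA : A.Nonempty) :
    finEntropy (fun x => if x ∈ A then (A.card : ℝ)⁻¹ else 0) = Real.log A.card := by
  have hc : (A.card : ℝ) ≠ 0 := by exact_mod_cast hA.card_pos.ne'
  unfold finEntropy
  simp_rw [apply_ite Real.negMulLog, Real.negMulLog_zero]
  rw [Finset.sum_ite_mem, Finset.univ_inter, Finset.sum_const, nsmul_eq_mul, Real.negMulLog,
    Real.log_inv]
  field_simp

/-- The lower bound for `B` in nats. -/
lemma binEntropy_noiseParam_mul_le {n : ℕ} {p τ : ℝ} {A B : Finset (Fin n → Bool)} (hn : 2 ≤ n)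
    (hp0 : 0 ≤ p) (hp1 : p ≤ 1) (hτ0 : 0 < τ) (hτ1 : τ < 1)
    (hAB : ∀ x ∈ A, 1 / (n : ℝ) ≤ ∑ y ∈ B, noiseWeight τ x y) (hA : A.Nonempty)
    (hB : B.Nonempty) (hpA : Real.binEntropy p * n ≤ Real.log A.card) :
    Real.binEntropy (noiseParam p τ) * n ≤ Real.log B.card + 2 * Real.log 2 + 1
      + 5 / 2 * (Real.sqrt n * (Real.sqrt (Real.log n) * Real.log n)) := by
  obtain ⟨s, hs0, hs⟩ := exists_supportsNoise hτ0 hτ1 hp0 hp1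
  have hn0 : (0 : ℝ) < n := by positivity
  have hℓ : 0 < Real.log n := Real.log_pos (by exact_mod_cast hn)
  set ℓ := Real.log n with hℓdef
  have hAc : (A.card : ℝ) ≠ 0 := by exact_mod_cast hA.card_pos.ne'
  have hBc : (B.card : ℝ) ≠ 0 := by exact_mod_cast hB.card_pos.ne'
  set P : (Fin n → Bool) → ℝ := fun x => if x ∈ A then (A.card : ℝ)⁻¹ else 0 with hPdef
  have hP : ∀ x, 0 ≤ P x := fun x => by simp only [P]; split_ifs <;> positivity
  have hP1 : ∑ x, P x = 1 := by
    simp only [P]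
    rw [Finset.sum_ite_mem, Finset.univ_inter, Finset.sum_const, nsmul_eq_mul,
      mul_inv_cancel₀ hAc]
  have hmgl := finEntropy_noise_ge hτ0 hτ1 hs P hP hP1
  rw [finEntropy_uniform hA] at hmgl
  -- With `l = √(ℓ/n)` the tail exponent is `ℓ/2 - 5ℓ/2 = -2ℓ`; after the loss `m⁻¹ = n` a tail of
  -- exactly `1/n` remains.
  set r : ℝ := 5 / 2 * Real.sqrt (n * ℓ) with hr
  set S := hammingThickening r B with hS
  have hr0 : 0 ≤ r := by positivity
  have hSne : S.Nonempty := hB.mono (subset_hammingThickening hr0 B)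
  have htail : ∀ x ∈ A, ∑ y ∈ Sᶜ, noiseWeight τ x y ≤ 1 / n := by
    intro x hx
    have h := sum_noiseWeight_compl_hammingThickening_le (r := r) hτ0 hτ1
      (Real.sqrt_nonneg (ℓ / n)) (by positivity) x hB (hAB x hx)
    refine h.trans_eq ?_
    have e1 : Real.sqrt (ℓ / n) * r = 5 / 2 * ℓ := by
      rw [hr, mul_left_comm, ← Real.sqrt_mul (by positivity),
        show ℓ / n * (n * ℓ) = ℓ * ℓ by field_simp, Real.sqrt_mul_self hℓ.le]
    have e2 : (n : ℝ) * Real.sqrt (ℓ / n) ^ 2 / 2 = ℓ / 2 := by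
      rw [Real.sq_sqrt (by positivity)]; field_simp
    rw [e1, e2, show ℓ / 2 - 5 / 2 * ℓ = -ℓ + -ℓ by ring, Real.exp_add, Real.exp_neg, hℓdef,
      Real.exp_log hn0]
    field_simp
  have hQ : ∀ y, 0 ≤ ∑ x, P x * noiseWeight τ x y := fun y =>
    Finset.sum_nonneg fun x _ => mul_nonneg (hP x) (noiseWeight_pos hτ0 hτ1 x y).le
  have hQ1 : ∑ y, ∑ x, P x * noiseWeight τ x y = 1 := by
    rw [Finset.sum_comm]
    simp_rw [← Finset.mul_sum, sum_noiseWeight, mul_one]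
    exact hP1
  have hQS : ∑ y ∈ Sᶜ, ∑ x, P x * noiseWeight τ x y ≤ 1 / n := by
    rw [Finset.sum_comm]
    calc _ ≤ ∑ x, P x * (1 / n) := by
          refine Finset.sum_le_sum fun x _ => ?_
          rw [← Finset.mul_sum]
          by_cases hx : x ∈ A
          · exact mul_le_mul_of_nonneg_left (htail x hx) (hP x)
          · simp [P, hx]
      _ = _ := by rw [← Finset.sum_mul, hP1, one_mul]
  have hup := finEntropy_le_of_concentrated _ hQ hQ1 S hSne hQS
  have hcard : Real.log (Fintype.card (Fin n → Bool)) = n * Real.log 2 := by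
    simp [Real.log_pow]
  have hlogS : Real.log S.card ≤ Real.log B.card + 1 + r * ℓ := by
    calc _ ≤ Real.log (B.card * (Real.exp 1 * (n : ℝ) ^ r)) :=
          Real.log_le_log (by exact_mod_cast hSne.card_pos)
            (card_hammingThickening_le (by omega) r B)
      _ = _ := by
          rw [Real.log_mul hBc (by positivity), Real.log_mul (Real.exp_pos 1).ne' (by positivity),
            Real.log_exp, Real.log_rpow hn0, add_assoc]
  have hrl : r * ℓ = 5 / 2 * (Real.sqrt n * (Real.sqrt ℓ * ℓ)) := by
    rw [hr, Real.sqrt_mul hn0.le]; ring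
  -- The exceptional mass `1/n` costs only one bit against the full entropy `n log 2`.
  have hn2 : 1 / (n : ℝ) * (n * Real.log 2) = Real.log 2 := by field_simp
  rw [hcard, hn2] at hup
  -- Here `s ≥ 0` matters: `s log #A` absorbs the term `-s H(p) n` of the supporting line.
  have := mul_le_mul_of_nonneg_left hpA hs0
  linarith

theorem mainTheorem5 :
    ∃ C : ℝ, 0 < C ∧
      ∀ (n : ℕ) (p τ α β : ℝ) (A B : Finset (Fin n → Bool)),
        1 ≤ n → 0 ≤ p → p ≤ 1 → 0 < τ → τ < 1 →
        α = shannonH p → β = shannonH (noiseParam p τ) →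
        (∀ x ∈ A, 1 / (n : ℝ) ≤ (noise τ x).real (B : Set (Fin n → Bool))) →
        A.Nonempty → α * n ≤ Real.logb 2 (A.card : ℝ) →
        B.Nonempty ∧
          β * n - C * (Real.sqrt n * Real.logb 2 (n : ℝ) ^ (3 / 2 : ℝ)) ≤
            Real.logb 2 (B.card : ℝ) := by
  -- In nats the loss is at most `2 log 2 + 1 + 5/2 < 5` times the error term once that is at least
  -- `1`, and `10 log 2 > 6.9`.
  refine ⟨10, by norm_num, ?_⟩
  intro n p τ α β A B hn hp0 hp1 hτ0 hτ1 hα hβ hAB hA hαA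
  simp_rw [noise_real_eq hτ0 hτ1] at hAB
  have hn0 : (0 : ℝ) < n := by exact_mod_cast hn
  have hB : B.Nonempty := by
    obtain ⟨x, hx⟩ := hA
    by_contra h
    have h1 := hAB x hx
    rw [Finset.not_nonempty_iff_eq_empty.1 h, Finset.sum_empty] at h1
    exact absurd h1 (not_le.2 (by positivity))
  refine ⟨hB, ?_⟩
  have hl2 : 0 < Real.log 2 := Real.log_pos one_lt_two
  -- For `n = 1` the error term vanishes, but hitting `B` with probability `1` forces `B` to be
  -- everything, as all transition weights are positive.
  rcases hn.eq_or_lt with rfl | hn2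
  · obtain ⟨x, hx⟩ := hA
    have hBu : B = Finset.univ := by
      by_contra h
      have h1 := hAB x hx
      obtain ⟨y, -, hy⟩ := Finset.exists_of_ssubset
        (Finset.ssubset_univ_iff.2 h)
      have h2 := Finset.sum_lt_sum_of_subset (Finset.subset_univ B) (Finset.mem_univ y) hy
        (noiseWeight_pos hτ0 hτ1 x y) (fun j _ _ => (noiseWeight_pos hτ0 hτ1 x j).le)
      rw [sum_noiseWeight] at h2
      norm_num at h1
      linarith
    have h1 : β ≤ 1 := by
      rw [hβ, shannonH, div_le_one hl2]
      exact Real.binEntropy_le_log_two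
    have h2 : Real.logb 2 (B.card : ℝ) = 1 := by
      rw [hBu]; simp
    rw [h2]
    norm_num
    exact h1
  · have hpA : Real.binEntropy p * n ≤ Real.log A.card := by
      rw [hα, shannonH, Real.logb, div_mul_eq_mul_div, div_le_div_iff_of_pos_right hl2] at hαA
      exact hαA
    have key := binEntropy_noiseParam_mul_le hn2 hp0 hp1 hτ0 hτ1 hAB hA hB hpA
    set L := Real.logb 2 (n : ℝ) with hL
    have hlog : Real.log n = L * Real.log 2 := by
      rw [hL, Real.logb, div_mul_cancel₀ _ hl2.ne']
    have hL1 : 1 ≤ L := by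
      rw [hL, Real.le_logb_iff_rpow_le one_lt_two hn0, Real.rpow_one]
      exact_mod_cast hn2
    have hlu : Real.log 2 < 0.7 := by linarith [Real.log_two_lt_d9]
    have hll : 0.69 < Real.log 2 := by linarith [Real.log_two_gt_d9]
    have hL0 : 0 ≤ L := by linarith
    have hlogL : Real.log n ≤ L := by rw [hlog]; nlinarith
    have hlog0 : 0 ≤ Real.log n := Real.log_natCast_nonneg n
    have hpow : L ^ (3 / 2 : ℝ) = Real.sqrt L * L := by
      rw [show (3 / 2 : ℝ) = 1 / 2 + 1 by norm_num, Real.rpow_add (by linarith), Real.rpow_one,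
        Real.sqrt_eq_rpow]
    have hs1 : 1 ≤ Real.sqrt n := Real.one_le_sqrt.2 (by exact_mod_cast hn)
    have hsL : 1 ≤ Real.sqrt L := Real.one_le_sqrt.2 hL1
    have h1 : Real.sqrt n * (Real.sqrt (Real.log n) * Real.log n) ≤
        Real.sqrt n * (Real.sqrt L * L) := by gcongr
    have h2 : 1 ≤ Real.sqrt n * (Real.sqrt L * L) :=
      one_le_mul_of_one_le_of_one_le hs1 (one_le_mul_of_one_le_of_one_le hsL hL1)
    rw [hβ, shannonH, hpow, Real.logb, div_mul_eq_mul_div, sub_le_iff_le_add,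
      div_le_iff₀ hl2, add_mul, div_mul_cancel₀ _ hl2.ne']
    nlinarith
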